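/- Let $k$ be an algebraically closed field of characteristic zero and $R=k[x_0,x_1,x_2]$. A set of fat points $Z=m_1P_1+\cdots+m_sP_s$ in $\mathbb{P}^2$ (distinct points $P_i$, integers $m_i\ge 1$) has ideal $I_Z=\bigcap_i I_{P_i}^{m_i}$ and Hilbert function $H_Z(t)=\dim_k (R/I_Z)_t$; $P_i$ is a double point of $Z$ if $m_i=2$ and a reduced point of $Z$ if $m_i=1$. Let $\Delta H=(h_0,\ldots,h_\sigma)=(1,2,\ldots,\alpha,h_\alpha,\ldots,h_\sigma)$ be a valid Hilbert function, i.e. a sequence of positive integers (with $h_i=0$ for $i>\sigma$) for which $1\le\alpha\le\sigma+1$, $h_i=i+1$ for $0\le i<\alpha$, and $h_i\ge h_{i+1}$ for all $i\ge\alpha-1$. Put $H(t)=\sum_{j=0}^{t}h_j$, $\sum\Delta H=\sum_{j=0}^{\sigma}h_j$, $h_i^\star=\#\{j\mid h_j\ge i\}$ for $1\le i\le\alpha$, $n_+=\max\{n,0\}$, and $$d=\sum_{i=1}^{\alpha-1}\min\left\{\left\lfloor\frac{(h_i^\star-(i-1))_+}{2}\right\rfloor,\ \#\{k\mid i+1\le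 k\le\alpha\text{ and }h_k^\star\ge i\}\right\}.$$ Then: (i) $\min\left\{\left\lfloor\frac{\sigma+1}{2}\right\rfloor,\alpha-1\right\}\le d\le\binom{\alpha}{2}$. (ii) For every integer $1\le e\le d$ there exists a set of fat points $Z\subseteq\mathbb{P}^2$ consisting of exactly $e$ double points and $(\sum\Delta H)-3e\ge 0$ reduced points with $H_Z=H$. (iii) For $e=\min\left\{\left\lfloor\frac{\sigma+1}{2}\right\rfloor,\alpha-1\right\}$ there exists a set of fat points $Z\subseteq\mathbb{P}^2$ consisting of exactly $e$ double points and $(\sum\Delta H)-3e\ge 0$ reduced points with $H_Z=H$. -/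

import Mathlib

open MvPolynomial

noncomputable section

/-- The projective plane over `k`. -/
abbrev Plane (k : Type*) [Field k] : Type _ := Projectivization k (Fin 3 → k)

/-- The homogeneous ideal `I_P` in `k[x₀, x₁, x₂]` of a point `P` of the plane: it is generated
by the homogeneous polynomials that vanish at `P`. -/
def pointIdeal {k : Type*} [Field k] (P : Plane k) : Ideal (MvPolynomial (Fin 3) k) :=
  Ideal.span {f | (∃ n : ℕ, f.IsHomogeneous n) ∧ MvPolynomial.eval P.rep f = 0}

/-- A set of fat points `m₁P₁ + ⋯ + mₛPₛ`: a finitely supported multiplicity function. -/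
abbrev FatPoints (k : Type*) [Field k] : Type _ := Plane k →₀ ℕ

namespace FatPoints

variable {k : Type*} [Field k]

/-- `I_Z = ⋂ I_{P_i}^{m_i}`. -/
def ideal (Z : FatPoints k) : Ideal (MvPolynomial (Fin 3) k) :=
  ⨅ P ∈ Z.support, pointIdeal P ^ Z P

/-- The graded piece `(I_Z)_i`, as a subspace of `R_i`. -/
def idealPiece (Z : FatPoints k) (i : ℕ) : Submodule k (homogeneousSubmodule (Fin 3) k i) :=
  (Z.ideal.restrictScalars k).comap (homogeneousSubmodule (Fin 3) k i).subtype

/-- `H_Z(i) = dim_k (R / I_Z)_i`, where `(R / I_Z)_i = R_i / (I_Z)_i`. -/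
def hilbertFunction (Z : FatPoints k) (i : ℕ) : ℕ :=
  Module.finrank k (homogeneousSubmodule (Fin 3) k i ⧸ Z.idealPiece i)

/-- `Z` consists of exactly `e` double points and `r` reduced points. -/
def ConsistsOf (Z : FatPoints k) (e r : ℕ) : Prop :=
  (∀ P ∈ Z.support, Z P = 1 ∨ Z P = 2) ∧
  (Z.support.filter fun P => Z P = 2).card = e ∧
  (Z.support.filter fun P => Z P = 1).card = r

end FatPoints

end

/-- `ΔH = (h 0, …, h σ) = (1, 2, …, α, h α, …, h σ)` is a valid Hilbert function. The sequence is
extended by zero after its last nonzero entry `h σ`. -/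
structure IsValidHilbertFunction (h : ℕ → ℕ) (α σ : ℕ) : Prop where
  alpha_pos : 0 < α
  alpha_le : α ≤ σ + 1
  pos : ∀ i ≤ σ, 0 < h i
  zero : ∀ i, σ < i → h i = 0
  initial : ∀ i < α, h i = i + 1
  /-- `h i ≥ h (i + 1)` for all `i ≥ α - 1`. -/
  anti : ∀ i, α ≤ i + 1 → h (i + 1) ≤ h i

/-- The function `H` with first difference `h`, that is `H i = h 0 + ⋯ + h i`. -/
def sumFunction (h : ℕ → ℕ) (i : ℕ) : ℕ := ∑ j ∈ Finset.range (i + 1), h j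

/-- `∑ ΔH`, the sum of all the entries of `(h 0, …, h σ)`. -/
def totalSum (h : ℕ → ℕ) (σ : ℕ) : ℕ := ∑ j ∈ Finset.range (σ + 1), h j

/-- The entry `h_i^⋆ = #{j | h_j ≥ i}` of the conjugate of `(h 0, …, h σ)`. -/
def conjugate (h : ℕ → ℕ) (σ i : ℕ) : ℕ := ((Finset.range (σ + 1)).filter fun j => i ≤ h j).card

/-- The integer `d`. Truncated subtraction of natural numbers is the positive part `(·)₊`,
and division of natural numbers rounds down. -/
def doublePointNumber (h : ℕ → ℕ) (α σ : ℕ) : ℕ :=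
  ∑ i ∈ Finset.Icc 1 (α - 1),
    min ((conjugate h σ i - (i - 1)) / 2)
      ((Finset.Icc (i + 1) α).filter fun k => i ≤ conjugate h σ k).card

/-!
Dividing by the equation of a line `L` turns `I_Z` into the ideal of the residual scheme, so that
`H_Z (t)` is `H_{Z'} (t - 1)` plus the number of conditions which `Z` imposes, by restriction, on
the forms of degree `t` on `L`; the latter number is at least `min (deg (Z ∩ L)) (t + 1)`. If lines
`L₀, …, L_{n - 1}` reduce `Z` to the empty scheme, and `cᵢ` is the degree on `Lᵢ` of what is left of
`Z` after the first `i` of them, this gives `H_Z (t) ≥ ∑ min cᵢ (t + 1 - i)`. When the `cᵢ` decrease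
strictly, equality holds: as long as `t + 1 ≤ c₀` the term of `L₀` is the full dimension `t + 1`,
and afterwards the right-hand side is the degree of `Z`.

For `cᵢ = h_{i + 1}^⋆` the right-hand side is `H (t)`. Take `α` lines in general position, put the
double points at intersections `Lᵢ ∩ Lⱼ` with `i < j`, which contribute `2` to `cᵢ` and `1` to `cⱼ`,
and fill up each line with reduced points. The choice is possible up to `d` double points: the line
`Lᵢ` receives at most `i` of them from the earlier lines, which leaves room for `⌊(cᵢ - i) / 2⌋` of
its own.
-/

section HomogeneousPolynomials

variable {ι A B : Type*} [CommRing A] [CommRing B] [Algebra A B]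

lemma aeval_const_mul_of_isHomogeneous {f : MvPolynomial ι A} {n : ℕ} (hf : f.IsHomogeneous n)
    (c : B) (v : ι → B) : aeval (fun i => c * v i) f = c ^ n * aeval v f := by
  rw [aeval_def, aeval_def, eval₂_eq, eval₂_eq, Finset.mul_sum]
  refine Finset.sum_congr rfl fun d hd => ?_
  have hdegree : ∑ i ∈ d.support, d i = n := (hf.degree_eq_sum_deg_support hd).symm
  simp only [mul_pow, Finset.prod_mul_distrib, Finset.prod_pow_eq_pow_sum, hdegree]
  ring

lemma aeval_mul_algebraMap_of_isHomogeneous {f : MvPolynomial ι A} {n : ℕ}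
    (hf : f.IsHomogeneous n) (c : B) (v : ι → A) :
    aeval (fun i => c * algebraMap A B (v i)) f = c ^ n * algebraMap A B (eval v f) := by
  rw [aeval_const_mul_of_isHomogeneous hf, ← Function.comp_def, aeval_algebraMap_apply,
    aeval_eq_eval]

lemma aeval_sub_aeval_mem {I : Ideal B} {φ ψ : ι → B} (h : ∀ i, φ i - ψ i ∈ I)
    (f : MvPolynomial ι A) : aeval φ f - aeval ψ f ∈ I := by
  have heq : (Ideal.Quotient.mkₐ A I).comp (aeval φ) = (Ideal.Quotient.mkₐ A I).comp (aeval ψ) :=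
    algHom_ext fun i => by simpa using Ideal.Quotient.eq.2 (h i)
  exact Ideal.Quotient.eq.1 (DFunLike.congr_fun heq f)

lemma exists_isHomogeneous_mul_eq_of_dvd {q f : MvPolynomial ι A} {d n : ℕ}
    (hq : q.IsHomogeneous d) (hf : f.IsHomogeneous (n + d)) (h : q ∣ f) :
    ∃ g : MvPolynomial ι A, g.IsHomogeneous n ∧ g * q = f := by
  obtain ⟨g, rfl⟩ := h
  let _ : GradedAlgebra (homogeneousSubmodule ι A) := MvPolynomial.gradedAlgebra
  refine ⟨DirectSum.decompose (homogeneousSubmodule ι A) g n,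
    (mem_homogeneousSubmodule n _).1 (SetLike.coe_mem _), ?_⟩
  rw [mul_comm q] at hf ⊢
  rw [← DirectSum.coe_decompose_mul_add_of_right_mem (homogeneousSubmodule ι A) hq,
    DirectSum.decompose_of_mem_same (homogeneousSubmodule ι A) hf]

end HomogeneousPolynomials

section Pencil

variable {ι k : Type*} [Field k] {v : ι → k} {l : MvPolynomial ι k}

/-- For a form `l` with `l(v) = 1`, the substitution that moves every coordinate along the line
from its value `v i * l` (at parameter `0`) to the variable `X i` (at parameter `1`). The order of
vanishing in the parameter measures the order of vanishing at `v`. -/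
noncomputable def pencil (v : ι → k) (l : MvPolynomial ι k) :
    MvPolynomial ι k →ₐ[k] Polynomial (MvPolynomial ι k) :=
  aeval fun i => Polynomial.C (C (v i) * l) + Polynomial.X * Polynomial.C (X i - C (v i) * l)

lemma eval_pencil (s f : MvPolynomial ι k) :
    (pencil v l f).eval s = aeval (fun i => C (v i) * l + s * (X i - C (v i) * l)) f := by
  induction f using MvPolynomial.induction_on with
  | C a => simp [pencil, algebraMap_eq]
  | add p q hp hq => simp only [map_add, Polynomial.eval_add, hp, hq]
  | mul_X p i hp =>
    simp only [map_mul, Polynomial.eval_mul, hp, aeval_X]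
    simp [pencil]

lemma eval_one_pencil (f : MvPolynomial ι k) : (pencil v l f).eval 1 = f := by
  rw [eval_pencil]
  simp

lemma coeff_zero_pencil {f : MvPolynomial ι k} {n : ℕ} (hf : f.IsHomogeneous n) :
    (pencil v l f).coeff 0 = l ^ n * C (eval v f) := by
  rw [Polynomial.coeff_zero_eq_eval_zero, eval_pencil,
    ← algebraMap_eq, ← aeval_mul_algebraMap_of_isHomogeneous hf]
  simp [mul_comm]

lemma pencil_mem_reesAlgebra {I : Ideal (MvPolynomial ι k)} (hI : ∀ i, X i - C (v i) * l ∈ I)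
    (f : MvPolynomial ι k) : pencil v l f ∈ reesAlgebra I := by
  induction f using MvPolynomial.induction_on with
  | C a =>
    rw [pencil, aeval_C]
    exact (reesAlgebra I).algebraMap_mem (C a)
  | add p q hp hq => simpa only [map_add] using add_mem hp hq
  | mul_X p i hp =>
    have hlinear : Polynomial.monomial 1 (X i - C (v i) * l) ∈ reesAlgebra I :=
      reesAlgebra.monomial_mem.2 (by simpa only [pow_one] using hI i)
    have hX : pencil v l (X i) ∈ reesAlgebra I := by
      rw [pencil, aeval_X, Polynomial.X_mul_C, Polynomial.C_mul_X_eq_monomial]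
      exact add_mem ((reesAlgebra I).algebraMap_mem (C (v i) * l)) hlinear
    rw [map_mul]
    exact mul_mem hp hX

end Pencil

section PointIdeal

variable {k : Type*} [Field k] {P : Plane k} {l : MvPolynomial (Fin 3) k}

lemma mem_pointIdeal_iff {f : MvPolynomial (Fin 3) k} {n : ℕ} (hf : f.IsHomogeneous n) :
    f ∈ pointIdeal P ↔ eval P.rep f = 0 := by
  have hle : pointIdeal P ≤ RingHom.ker (eval P.rep) := Ideal.span_le.2 fun g hg => hg.2
  exact ⟨fun h => hle h, fun h => Ideal.subset_span ⟨⟨n, hf⟩, h⟩⟩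

lemma exists_linear_eval_rep_eq_one (P : Plane k) :
    ∃ l : MvPolynomial (Fin 3) k, l.IsHomogeneous 1 ∧ eval P.rep l = 1 := by
  obtain ⟨j, hj⟩ := Function.ne_iff.1 P.rep_nonzero
  exact ⟨C (P.rep j)⁻¹ * X j, isHomogeneous_C_mul_X _ _, by simpa using inv_mul_cancel₀ hj⟩

lemma mem_pointIdeal_pow_iff_X_pow_dvd_pencil (hl : l.IsHomogeneous 1) (hlP : eval P.rep l = 1)
    {m : ℕ} {f : MvPolynomial (Fin 3) k} :
    f ∈ pointIdeal P ^ m ↔ Polynomial.X ^ m ∣ pencil P.rep l f := by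
  constructor
  · intro hf
    have hle : (pointIdeal P).map (pencil P.rep l) ≤ Ideal.span {Polynomial.X} := by
      refine Ideal.map_le_iff_le_comap.2 (Ideal.span_le.2 ?_)
      rintro g ⟨⟨n, hg⟩, hgP⟩
      rw [SetLike.mem_coe, Ideal.mem_comap, Ideal.mem_span_singleton, Polynomial.X_dvd_iff,
        coeff_zero_pencil hg, hgP, map_zero, mul_zero]
    rw [← Ideal.mem_span_singleton, ← Ideal.span_singleton_pow]
    exact Ideal.pow_right_mono hle m
      (Ideal.map_pow (pencil P.rep l) _ m ▸ Ideal.mem_map_of_mem _ hf)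
  · intro hdvd
    have hcoord (i : Fin 3) : X i - C (P.rep i) * l ∈ pointIdeal P :=
      (mem_pointIdeal_iff ((isHomogeneous_X k i).sub
        (by simpa using (isHomogeneous_C (Fin 3) (P.rep i)).mul hl))).2 (by simp [hlP])
    have hrees := (mem_reesAlgebra_iff _ _).1 (pencil_mem_reesAlgebra hcoord f)
    rw [← eval_one_pencil (v := P.rep) (l := l) f, Polynomial.eval_eq_sum_range]
    refine Ideal.sum_mem _ fun i _ => ?_
    rw [one_pow, mul_one]
    obtain him | hmi := lt_or_ge i m
    · rw [Polynomial.X_pow_dvd_iff.1 hdvd i him]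
      exact zero_mem _
    · exact Ideal.pow_le_pow_right hmi (hrees i)

lemma mul_mem_pointIdeal_pow_iff_of_eval_ne_zero {q g : MvPolynomial (Fin 3) k} {n m : ℕ}
    (hq : q.IsHomogeneous n) (hqP : eval P.rep q ≠ 0) :
    g * q ∈ pointIdeal P ^ m ↔ g ∈ pointIdeal P ^ m := by
  refine ⟨fun h => ?_, Ideal.mul_mem_right _ _⟩
  obtain ⟨l, hl, hlP⟩ := exists_linear_eval_rep_eq_one P
  have hl0 : l ≠ 0 := fun h0 => by simp [h0] at hlP
  rw [mem_pointIdeal_pow_iff_X_pow_dvd_pencil hl hlP, map_mul] at h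
  refine (mem_pointIdeal_pow_iff_X_pow_dvd_pencil hl hlP).2
    (Polynomial.prime_X.pow_dvd_of_dvd_mul_right m ?_ h)
  rw [Polynomial.X_dvd_iff, coeff_zero_pencil hq]
  exact mul_ne_zero (pow_ne_zero n hl0) (C_ne_zero.2 hqP)

end PointIdeal

section LinearForms

variable {ι k : Type*} [Fintype ι] [Field k]

/-- The linear form with coefficient vector `a`. -/
noncomputable def linearForm (a : ι → k) : MvPolynomial ι k := ∑ i, C (a i) * X i

lemma isHomogeneous_linearForm (a : ι → k) : (linearForm a).IsHomogeneous 1 :=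
  IsHomogeneous.sum _ _ _ fun _ _ => isHomogeneous_C_mul_X _ _

lemma eval_linearForm (v a : ι → k) : eval v (linearForm a) = a ⬝ᵥ v := by
  simp [linearForm, dotProduct]

lemma linearForm_ne_zero {a : ι → k} (ha : a ≠ 0) : linearForm a ≠ 0 := by
  classical
  intro hzero
  refine ha (funext fun i => ?_)
  simpa [hzero] using (eval_linearForm (Pi.single i 1) a).symm

lemma pencil_linearForm {v a : ι → k} (hav : a ⬝ᵥ v = 0) (l : MvPolynomial ι k) :
    pencil v l (linearForm a) = Polynomial.C (linearForm a) * Polynomial.X := by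
  have hterm (i : ι) : pencil v l (C (a i) * X i) =
      Polynomial.C (C (a i) * X i) * Polynomial.X +
        Polynomial.C (C (a i * v i)) * (Polynomial.C l * (1 - Polynomial.X)) := by
    simp only [pencil, map_mul, map_sub, aeval_X, algHom_C, algebraMap_eq,
      Polynomial.algebraMap_apply]
    ring
  rw [linearForm, map_sum, Finset.sum_congr rfl fun i _ => hterm i, Finset.sum_add_distrib,
    ← Finset.sum_mul, ← Finset.sum_mul, ← map_sum, ← map_sum, ← map_sum,
    show ∑ i, a i * v i = 0 from hav, map_zero, map_zero, zero_mul, add_zero]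

end LinearForms

section Hyperplanes

variable {k : Type*} [Field k] {n : ℕ}

/-- The restriction of polynomials to the hyperplane `a ⬝ᵥ x = 0`, on which the `j`-th coordinate
is eliminated; it requires `a j ≠ 0`. -/
noncomputable def hyperplaneRestrict (a : Fin (n + 1) → k) (j : Fin (n + 1)) :
    MvPolynomial (Fin (n + 1)) k →ₐ[k] MvPolynomial (Fin n) k :=
  aeval (j.insertNth (linearForm fun i => -(a (j.succAbove i) / a j)) X)

variable {a : Fin (n + 1) → k} {j : Fin (n + 1)}

lemma hyperplaneRestrict_rename (f : MvPolynomial (Fin n) k) :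
    hyperplaneRestrict a j (rename j.succAbove f) = f := by
  rw [hyperplaneRestrict, aeval_rename]
  simp [Function.comp_def]

lemma isHomogeneous_hyperplaneRestrict {f : MvPolynomial (Fin (n + 1)) k} {t : ℕ}
    (hf : f.IsHomogeneous t) : (hyperplaneRestrict a j f).IsHomogeneous t := by
  rw [← one_mul t]
  refine hf.aeval _ fun i => ?_
  cases i using j.succAboveCases <;> simp [isHomogeneous_linearForm, isHomogeneous_X]

lemma eval_hyperplaneRestrict (hj : a j ≠ 0) {v : Fin (n + 1) → k} (hv : a ⬝ᵥ v = 0)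
    (f : MvPolynomial (Fin (n + 1)) k) :
    eval (j.removeNth v) (hyperplaneRestrict a j f) = eval v f := by
  have hcoord : v j = ∑ i, -(a (j.succAbove i) / a j) * v (j.succAbove i) := by
    rw [dotProduct, Fin.sum_univ_succAbove _ j] at hv
    refine mul_left_cancel₀ hj ?_
    rw [eq_neg_of_add_eq_zero_left hv, Finset.mul_sum, ← Finset.sum_neg_distrib]
    exact Finset.sum_congr rfl fun i _ => by field_simp
  have heq : (aeval (j.removeNth v)).comp (hyperplaneRestrict a j) = aeval v := by
    refine algHom_ext fun i => ?_
    rw [AlgHom.comp_apply, hyperplaneRestrict, aeval_X, aeval_X, aeval_eq_eval]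
    cases i using j.succAboveCases with
    | x => simp [eval_linearForm, dotProduct, Fin.removeNth, hcoord]
    | p i => simp [Fin.removeNth]
  exact DFunLike.congr_fun heq f

lemma eq_zero_of_removeNth_eq_zero (hj : a j ≠ 0) {v : Fin (n + 1) → k} (hv : a ⬝ᵥ v = 0)
    (h : j.removeNth v = 0) : v = 0 := by
  have hother (i : Fin n) : v (j.succAbove i) = 0 := congrFun h i
  refine funext fun i => ?_
  cases i using j.succAboveCases with
  | x =>
    rw [dotProduct, Fin.sum_univ_succAbove _ j] at hv
    simpa [hother, hj] using hv
  | p i => exact hother i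

lemma C_mul_X_sub_rename_linearForm (hj : a j ≠ 0) :
    C (a j) * (X j - rename j.succAbove (linearForm fun i => -(a (j.succAbove i) / a j))) =
      linearForm a := by
  have hterm (i : Fin n) : C (a j) * (C (-(a (j.succAbove i) / a j)) * X (j.succAbove i)) =
      -(C (a (j.succAbove i)) * X (j.succAbove i) : MvPolynomial (Fin (n + 1)) k) := by
    rw [← mul_assoc, ← C_mul, mul_neg, mul_div_cancel₀ _ hj, C_neg, neg_mul]
  simp only [linearForm, map_sum, map_mul, rename_C, rename_X, mul_sub, Finset.mul_sum, hterm,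
    Fin.sum_univ_succAbove _ j, Finset.sum_neg_distrib, sub_neg_eq_add]

lemma hyperplaneRestrict_eq_zero_iff (hj : a j ≠ 0) {f : MvPolynomial (Fin (n + 1)) k} :
    hyperplaneRestrict a j f = 0 ↔ linearForm a ∣ f := by
  have hXj : hyperplaneRestrict a j (X j) = linearForm fun i => -(a (j.succAbove i) / a j) := by
    simp [hyperplaneRestrict]
  constructor
  · intro h
    have hcomp : aeval (fun i => rename j.succAbove (hyperplaneRestrict a j (X i))) =
        (rename j.succAbove).comp (hyperplaneRestrict a j) := algHom_ext fun i => by simp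
    have hmem := aeval_sub_aeval_mem (I := Ideal.span {linearForm a}) (φ := X)
      (ψ := fun i => rename j.succAbove (hyperplaneRestrict a j (X i))) (fun i => ?_) f
    · rwa [hcomp, AlgHom.comp_apply, h, map_zero, sub_zero, aeval_X_left_apply,
        Ideal.mem_span_singleton] at hmem
    · rw [Ideal.mem_span_singleton]
      cases i using j.succAboveCases with
      | x =>
        rw [hXj, ← C_mul_X_sub_rename_linearForm hj]
        exact ((isUnit_iff_ne_zero.2 hj).map C).mul_left_dvd.2 dvd_rfl
      | p i => simp [hyperplaneRestrict]
  · rintro ⟨g, rfl⟩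
    rw [← C_mul_X_sub_rename_linearForm hj, map_mul, map_mul, map_sub, hyperplaneRestrict_rename,
      hXj, sub_self, mul_zero, zero_mul]

lemma prime_linearForm {a : Fin (n + 1) → k} (ha : a ≠ 0) : Prime (linearForm a) := by
  obtain ⟨j, hj⟩ := Function.ne_iff.1 ha
  have hker : Ideal.span {linearForm a} = RingHom.ker (hyperplaneRestrict a j) := by
    ext f
    rw [Ideal.mem_span_singleton, RingHom.mem_ker, hyperplaneRestrict_eq_zero_iff hj]
  rw [← Ideal.span_singleton_prime (linearForm_ne_zero ha), hker]
  exact RingHom.ker_isPrime _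

end Hyperplanes

section BinaryForms

variable {k : Type*} [Field k] {w : Fin 2 → k}

/-- The linear form in two variables that vanishes at the point `w` of the projective line. -/
noncomputable def pointForm (w : Fin 2 → k) : MvPolynomial (Fin 2) k := linearForm ![w 1, -w 0]

lemma eval_pointForm (v w : Fin 2 → k) : eval v (pointForm w) = w 1 * v 0 - w 0 * v 1 := by
  simp [pointForm, eval_linearForm, dotProduct, sub_eq_add_neg]

lemma isHomogeneous_pointForm (w : Fin 2 → k) : (pointForm w).IsHomogeneous 1 :=
  isHomogeneous_linearForm _

lemma prime_pointForm (hw : w ≠ 0) : Prime (pointForm w) := by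
  refine prime_linearForm fun hzero => hw (funext fun i => ?_)
  have hw1 : w 1 = 0 := congrFun hzero 0
  have hw0 : w 0 = 0 := neg_eq_zero.1 (congrFun hzero 1)
  fin_cases i
  · exact hw0
  · exact hw1

lemma pointForm_dvd_of_eval_eq_zero (hw : w ≠ 0) {f : MvPolynomial (Fin 2) k} {n : ℕ}
    (hf : f.IsHomogeneous n) (hfw : eval w f = 0) : pointForm w ∣ f := by
  obtain ⟨j, hj⟩ := Function.ne_iff.1 hw
  have hmem := aeval_sub_aeval_mem (I := Ideal.span {pointForm w})
    (φ := fun i => C (w j) * X i) (ψ := fun i => X j * C (w i)) (fun i => ?_) f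
  · rw [aeval_const_mul_of_isHomogeneous hf, ← algebraMap_eq,
      aeval_mul_algebraMap_of_isHomogeneous hf, hfw, map_zero, mul_zero, sub_zero,
      aeval_X_left_apply, Ideal.mem_span_singleton, algebraMap_eq, ← C_pow] at hmem
    exact ((isUnit_iff_ne_zero.2 (pow_ne_zero n hj)).map C).dvd_mul_left.1 hmem
  · rw [Ideal.mem_span_singleton, pointForm, linearForm]
    fin_cases i <;> fin_cases j
    · simp [mul_comm]
    · simp [mul_comm, sub_eq_add_neg]
    · exact ⟨-1, by simp; ring⟩
    · simp [mul_comm]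

lemma isRelPrime_pointForm {v w : Fin 2 → k} (hv : v ≠ 0) (h : w 1 * v 0 ≠ w 0 * v 1) :
    IsRelPrime (pointForm v) (pointForm w) := by
  refine (prime_pointForm hv).irreducible.isRelPrime_iff_not_dvd.2 ?_
  rintro ⟨g, hg⟩
  have heval := congrArg (eval v) hg
  rw [map_mul, eval_pointForm, eval_pointForm, mul_comm (v 1), sub_self, zero_mul] at heval
  exact h (sub_eq_zero.1 heval)

end BinaryForms

section Codimension

open Module

variable {k A B D : Type*} [Field k] [AddCommGroup A] [Module k A] [AddCommGroup B] [Module k B]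
  [AddCommGroup D] [Module k D]

lemma finrank_eq_add_of_exact [FiniteDimensional k B] {i : A →ₗ[k] B} {π : B →ₗ[k] D}
    (hi : Function.Injective i) (hπ : Function.Surjective π)
    (h : LinearMap.ker π = LinearMap.range i) :
    finrank k B = finrank k A + finrank k D := by
  rw [← π.finrank_range_add_finrank_ker, h, LinearMap.range_eq_top.2 hπ, finrank_top,
    LinearMap.finrank_range_of_inj hi, add_comm]

lemma finrank_quotient_eq_add_of_exact [FiniteDimensional k B] {i : A →ₗ[k] B} {π : B →ₗ[k] D}
    (hi : Function.Injective i) (hπ : Function.Surjective π)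
    (h : LinearMap.ker π = LinearMap.range i) (V : Submodule k B) :
    finrank k (B ⧸ V) = finrank k (A ⧸ V.comap i) + finrank k (D ⧸ V.map π) := by
  have : FiniteDimensional k A := .of_injective i hi
  have : FiniteDimensional k D := .of_surjective π hπ
  have hV : finrank k V = finrank k (V.comap i) + finrank k (V.map π) := by
    refine finrank_eq_add_of_exact (i := i.restrict fun _ hx => hx)
      (π := π.restrict fun _ hx => Submodule.mem_map_of_mem hx) ?_ ?_ ?_
    · exact fun x y hxy => Subtype.ext (hi (congrArg Subtype.val hxy))
    · rintro ⟨_, x, hx, rfl⟩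
      exact ⟨⟨x, hx⟩, rfl⟩
    · ext ⟨x, hx⟩
      have hker : x ∈ LinearMap.ker π ↔ x ∈ LinearMap.range i := by rw [h]
      constructor
      · intro hx0
        obtain ⟨y, rfl⟩ := hker.1 (congrArg Subtype.val hx0)
        exact ⟨⟨y, hx⟩, rfl⟩
      · rintro ⟨y, hy⟩
        exact Subtype.ext (hker.2 ⟨y, congrArg Subtype.val hy⟩)
  have hB := finrank_eq_add_of_exact hi hπ h
  have hquotB := V.finrank_quotient_add_finrank
  have hquotA := (V.comap i).finrank_quotient_add_finrank
  have hquotD := (V.map π).finrank_quotient_add_finrank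
  omega

lemma finrank_quotient_map_le [FiniteDimensional k B] {π : B →ₗ[k] D} (hπ : Function.Surjective π)
    (V : Submodule k B) : finrank k (D ⧸ V.map π) ≤ finrank k (B ⧸ V) :=
  LinearMap.finrank_le_finrank_of_surjective
    (f := V.mapQ (V.map π) π (Submodule.le_comap_map π V)) fun y => by
    obtain ⟨d, rfl⟩ := Submodule.Quotient.mk_surjective _ y
    obtain ⟨b, rfl⟩ := hπ d
    exact ⟨Submodule.Quotient.mk b, rfl⟩

lemma finrank_quotient_anti [FiniteDimensional k B] {V W : Submodule k B} (h : V ≤ W) :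
    finrank k (B ⧸ W) ≤ finrank k (B ⧸ V) :=
  LinearMap.finrank_le_finrank_of_surjective (Submodule.factor_surjective h)

lemma finrank_quotient_iInf_le [FiniteDimensional k B] {ι : Type*} (T : Finset ι)
    (V : ι → Submodule k B) :
    finrank k (B ⧸ ⨅ i ∈ T, V i) ≤ ∑ i ∈ T, finrank k (B ⧸ V i) := by
  let φ : (B ⧸ ⨅ i ∈ T, V i) →ₗ[k] ∀ i : T, B ⧸ V i :=
    LinearMap.pi fun i => Submodule.factor (iInf₂_le i.1 i.2)
  have hφ : Function.Injective φ := by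
    rw [injective_iff_map_eq_zero]
    intro x hx
    obtain ⟨b, rfl⟩ := Submodule.Quotient.mk_surjective _ x
    refine (Submodule.Quotient.mk_eq_zero _).2 ?_
    simp only [Submodule.mem_iInf]
    exact fun i hi => (Submodule.Quotient.mk_eq_zero _).1 (congrFun hx ⟨i, hi⟩)
  calc finrank k (B ⧸ ⨅ i ∈ T, V i) ≤ finrank k (∀ i : T, B ⧸ V i) :=
        LinearMap.finrank_le_finrank_of_injective hφ
    _ = ∑ i ∈ T, finrank k (B ⧸ V i) := by
        rw [finrank_pi_fintype, Finset.sum_coe_sort T fun i => finrank k (B ⧸ V i)]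

end Codimension

section GradedPieces

open Module

variable {ι k : Type*} [Field k]

instance finiteDimensional_homogeneousSubmodule [Finite ι] (t : ℕ) :
    FiniteDimensional k (homogeneousSubmodule ι k t) :=
  Module.Finite.iff_fg.2 (homogeneousSubmodule_fg ι k t)

lemma finrank_homogeneousSubmodule (ι k : Type*) [Fintype ι] [Field k] (t : ℕ) :
    finrank k (homogeneousSubmodule ι k t) = (Fintype.card ι + t - 1).choose t := by
  classical
  have hset : {d : ι →₀ ℕ | d.degree = t} =
      ((Finset.univ.finsuppAntidiag t : Finset (ι →₀ ℕ)) : Set (ι →₀ ℕ)) := by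
    ext d
    simp [Finsupp.degree_eq_sum]
  rw [homogeneousSubmodule_eq_finsupp_supported, hset,
    (AddMonoidAlgebra.supportedEquivFinsupp _).finrank_eq, finrank_finsupp_self]
  simp [Finset.card_finsuppAntidiag_nat_eq_choose]

/-- Multiplication by a form `q` of degree `d`, from degree `t` to degree `t + d`. -/
noncomputable def mulForm {q : MvPolynomial ι k} {d : ℕ} (hq : q.IsHomogeneous d) (t : ℕ) :
    homogeneousSubmodule ι k t →ₗ[k] homogeneousSubmodule ι k (t + d) :=
  (LinearMap.mulRight k q).restrict fun _ hf => hf.mul hq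

lemma mulForm_injective {q : MvPolynomial ι k} {d : ℕ} (hq : q.IsHomogeneous d) (hq0 : q ≠ 0)
    (t : ℕ) : Function.Injective (mulForm hq t) := fun _ _ h =>
  Subtype.ext (mul_right_cancel₀ hq0 (congrArg Subtype.val h))

lemma mem_range_mulForm {q : MvPolynomial ι k} {d : ℕ} (hq : q.IsHomogeneous d) {t : ℕ}
    {f : homogeneousSubmodule ι k (t + d)} :
    f ∈ LinearMap.range (mulForm hq t) ↔ q ∣ (f : MvPolynomial ι k) := by
  constructor
  · rintro ⟨g, rfl⟩
    exact dvd_mul_left q g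
  · intro h
    obtain ⟨g, hg, hgf⟩ := exists_isHomogeneous_mul_eq_of_dvd hq f.2 h
    exact ⟨⟨g, hg⟩, Subtype.ext hgf⟩

/-- The restriction of forms of degree `t` to the hyperplane `a ⬝ᵥ x = 0`. -/
noncomputable def restrictForm {n : ℕ} (a : Fin (n + 1) → k) (j : Fin (n + 1)) (t : ℕ) :
    homogeneousSubmodule (Fin (n + 1)) k t →ₗ[k] homogeneousSubmodule (Fin n) k t :=
  (hyperplaneRestrict a j).toLinearMap.restrict fun _ hf => isHomogeneous_hyperplaneRestrict hf

lemma restrictForm_surjective {n : ℕ} (a : Fin (n + 1) → k) (j : Fin (n + 1)) (t : ℕ) :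
    Function.Surjective (restrictForm a j t) := fun f =>
  ⟨⟨rename j.succAbove f, f.2.rename_isHomogeneous⟩, Subtype.ext (hyperplaneRestrict_rename _)⟩

lemma ker_restrictForm {n : ℕ} {a : Fin (n + 1) → k} {j : Fin (n + 1)} (hj : a j ≠ 0) (t : ℕ) :
    LinearMap.ker (restrictForm a j (t + 1)) =
      LinearMap.range (mulForm (isHomogeneous_linearForm a) t) := by
  ext f
  rw [mem_range_mulForm, ← hyperplaneRestrict_eq_zero_iff hj, LinearMap.mem_ker, Subtype.ext_iff]
  rfl

lemma finrank_binaryForms (k : Type*) [Field k] (t : ℕ) :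
    finrank k (homogeneousSubmodule (Fin 2) k t) = t + 1 := by
  rw [finrank_homogeneousSubmodule, Fintype.card_fin, show 2 + t - 1 = t + 1 by omega,
    Nat.choose_succ_self_right]

lemma finrank_quotient_binaryForms_le {t d : ℕ} {q : MvPolynomial (Fin 2) k}
    (hq : q.IsHomogeneous d) (hq0 : q ≠ 0) {V : Submodule k (homogeneousSubmodule (Fin 2) k t)}
    (hV : ∀ f : homogeneousSubmodule (Fin 2) k t, q ∣ (f : MvPolynomial (Fin 2) k) → f ∈ V) :
    finrank k (_ ⧸ V) ≤ d := by
  have hsum := V.finrank_quotient_add_finrank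
  rw [finrank_binaryForms] at hsum
  obtain htd | ⟨s, rfl⟩ := (lt_or_ge t d).imp_right Nat.exists_eq_add_of_le'
  · omega
  · have hle : LinearMap.range (mulForm hq s) ≤ V := fun f hf => hV f ((mem_range_mulForm hq).1 hf)
    have hrank := Submodule.finrank_mono hle
    rw [LinearMap.finrank_range_of_inj (mulForm_injective hq hq0 s), finrank_binaryForms] at hrank
    omega

lemma min_le_finrank_quotient_binaryForms {t d : ℕ} {q : MvPolynomial (Fin 2) k}
    (hq : q.IsHomogeneous d) (hq0 : q ≠ 0) {V : Submodule k (homogeneousSubmodule (Fin 2) k t)}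
    (hV : ∀ f ∈ V, q ∣ (f : MvPolynomial (Fin 2) k)) :
    min d (t + 1) ≤ finrank k (_ ⧸ V) := by
  have hsum := V.finrank_quotient_add_finrank
  rw [finrank_binaryForms] at hsum
  obtain htd | ⟨s, rfl⟩ := (lt_or_ge t d).imp_right Nat.exists_eq_add_of_le'
  · have hbot : V = ⊥ := (Submodule.eq_bot_iff V).2 fun f hf => by
      by_contra hf0
      obtain ⟨g, hg⟩ := hV f hf
      have hfne : (f : MvPolynomial (Fin 2) k) ≠ 0 := fun h => hf0 (Subtype.ext h)
      have hg0 : g ≠ 0 := fun h => hfne (by rw [hg, h, mul_zero])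
      have hdeg := totalDegree_mul_of_isDomain hq0 hg0
      rw [← hg, IsHomogeneous.totalDegree f.2 hfne, hq.totalDegree hq0] at hdeg
      omega
    rw [hbot, finrank_bot] at hsum
    rw [hbot]
    omega
  · have hle : V ≤ LinearMap.range (mulForm hq s) := fun f hf => (mem_range_mulForm hq).2 (hV f hf)
    have hrank := Submodule.finrank_mono hle
    rw [LinearMap.finrank_range_of_inj (mulForm_injective hq hq0 s), finrank_binaryForms] at hrank
    omega

end GradedPieces

section Incidence

variable {k : Type*} [Field k] {P Q : Plane k} {a : Fin 3 → k} {j : Fin 3}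

/-- The point `P` lies on the line with equation `a ⬝ᵥ x = 0`. -/
def OnLine (P : Plane k) (a : Fin 3 → k) : Prop := a ⬝ᵥ P.rep = 0

lemma exists_onLine (P : Plane k) : ∃ a : Fin 3 → k, a ≠ 0 ∧ OnLine P a := by
  obtain ⟨j, hj⟩ := Function.ne_iff.1 P.rep_nonzero
  refine ⟨Pi.single (j + 1) (P.rep j) - Pi.single j (P.rep (j + 1)), fun h => hj ?_, ?_⟩
  · simpa using congrFun h (j + 1)
  · rw [OnLine, sub_dotProduct, single_dotProduct, single_dotProduct, mul_comm, sub_self]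

lemma mul_linearForm_mem_pointIdeal_pow_succ_iff (ha : a ≠ 0) (haP : OnLine P a) {m : ℕ}
    {g : MvPolynomial (Fin 3) k} :
    g * linearForm a ∈ pointIdeal P ^ (m + 1) ↔ g ∈ pointIdeal P ^ m := by
  obtain ⟨l, hl, hlP⟩ := exists_linear_eval_rep_eq_one P
  have hX : ¬ (Polynomial.X : Polynomial (MvPolynomial (Fin 3) k)) ∣
      Polynomial.C (linearForm a) := by
    rw [Polynomial.X_dvd_iff, Polynomial.coeff_C_zero]
    exact linearForm_ne_zero ha
  rw [mem_pointIdeal_pow_iff_X_pow_dvd_pencil hl hlP,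
    mem_pointIdeal_pow_iff_X_pow_dvd_pencil hl hlP, map_mul, pencil_linearForm haP, ← mul_assoc,
    pow_succ, mul_dvd_mul_iff_right Polynomial.X_ne_zero]
  exact ⟨Polynomial.prime_X.pow_dvd_of_dvd_mul_right m hX, fun h => h.mul_right _⟩

lemma removeNth_rep_ne_zero (hj : a j ≠ 0) (hP : OnLine P a) : j.removeNth P.rep ≠ 0 :=
  fun h => P.rep_nonzero (eq_zero_of_removeNth_eq_zero hj hP h)

lemma isRelPrime_pointForm_removeNth_rep (hj : a j ≠ 0) (hP : OnLine P a) (hQ : OnLine Q a)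
    (hPQ : P ≠ Q) :
    IsRelPrime (pointForm (j.removeNth P.rep)) (pointForm (j.removeNth Q.rep)) := by
  have hP0 := removeNth_rep_ne_zero hj hP
  refine isRelPrime_pointForm hP0 fun hcross => hPQ ?_
  obtain ⟨i, hi⟩ := Function.ne_iff.1 hP0
  have hproportional : j.removeNth Q.rep i • P.rep - j.removeNth P.rep i • Q.rep = 0 := by
    refine eq_zero_of_removeNth_eq_zero hj ?_ (funext fun i' => ?_)
    · rw [dotProduct_sub, dotProduct_smul, dotProduct_smul, hP, hQ, smul_zero, smul_zero, sub_zero]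
    · change j.removeNth Q.rep i * j.removeNth P.rep i' -
        j.removeNth P.rep i * j.removeNth Q.rep i' = 0
      fin_cases i <;> fin_cases i' <;> simp only [Fin.mk_zero, Fin.mk_one] <;> grind
  rw [← P.mk_rep, ← Q.mk_rep, eq_comm, Projectivization.mk_eq_mk_iff']
  refine ⟨(j.removeNth P.rep i)⁻¹ * j.removeNth Q.rep i, ?_⟩
  rw [mul_smul, sub_eq_zero.1 hproportional, inv_smul_smul₀ hi]

lemma pointForm_pow_dvd_hyperplaneRestrict (hj : a j ≠ 0) (hP : OnLine P a) {m : ℕ}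
    {f : MvPolynomial (Fin 3) k} (hf : f ∈ pointIdeal P ^ m) :
    pointForm (j.removeNth P.rep) ^ m ∣ hyperplaneRestrict a j f := by
  have hle : (pointIdeal P).map (hyperplaneRestrict a j) ≤
      Ideal.span {pointForm (j.removeNth P.rep)} := by
    refine Ideal.map_le_iff_le_comap.2 (Ideal.span_le.2 ?_)
    rintro g ⟨⟨n, hg⟩, hgP⟩
    refine Ideal.mem_span_singleton.2 (pointForm_dvd_of_eval_eq_zero (removeNth_rep_ne_zero hj hP)
      (isHomogeneous_hyperplaneRestrict hg) ?_)
    rw [eval_hyperplaneRestrict hj hP, hgP]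
  rw [← Ideal.mem_span_singleton, ← Ideal.span_singleton_pow]
  exact Ideal.pow_right_mono hle m
    (Ideal.map_pow (hyperplaneRestrict a j) _ m ▸ Ideal.mem_map_of_mem _ hf)

lemma rename_pointForm_mem_pointIdeal (P : Plane k) (j : Fin 3) :
    rename j.succAbove (pointForm (j.removeNth P.rep)) ∈ pointIdeal P := by
  rw [mem_pointIdeal_iff (isHomogeneous_pointForm _).rename_isHomogeneous, eval_rename]
  exact (eval_pointForm _ _).trans (sub_eq_zero.2 (mul_comm _ _))

end Incidence

namespace FatPoints

variable {k : Type*} [Field k] (Z : FatPoints k) (a : Fin 3 → k)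

open scoped Classical in
/-- The residual scheme of `Z` with respect to the line `a ⬝ᵥ x = 0`: all multiplicities at points
of the line drop by one. -/
noncomputable def residual : FatPoints k :=
  Finsupp.onFinset Z.support (fun P => if OnLine P a then Z P - 1 else Z P) fun P h => by
    rw [Finsupp.mem_support_iff]
    contrapose! h
    simp [h]

open scoped Classical in
/-- The degree of the intersection of `Z` with the line `a ⬝ᵥ x = 0`: the sum of the multiplicities
of `Z` at the points of the line. -/
noncomputable def lineDegree : ℕ := ∑ P ∈ Z.support with OnLine P a, Z P

/-- The degree of the scheme `Z`, where a point of multiplicity `m` contributes `m (m + 1) / 2`. -/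
noncomputable def degree : ℕ := Z.sum fun _ m => (m + 1).choose 2

/-- The number of conditions that `Z` imposes, through restriction to the line `a ⬝ᵥ x = 0`, on
the forms of degree `t` on that line. -/
noncomputable def lineConditions (j : Fin 3) (t : ℕ) : ℕ :=
  Module.finrank k (homogeneousSubmodule (Fin 2) k t ⧸ (Z.idealPiece t).map (restrictForm a j t))

variable {Z a} {P : Plane k} {j : Fin 3}

lemma residual_apply_of_onLine (h : OnLine P a) : residual Z a P = Z P - 1 := if_pos h

lemma residual_apply_of_not_onLine (h : ¬ OnLine P a) : residual Z a P = Z P := if_neg h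

lemma residual_single_of_onLine (h : OnLine P a) (m : ℕ) :
    residual (Finsupp.single P m) a = Finsupp.single P (m - 1) := by
  classical
  ext Q
  by_cases hQ : OnLine Q a <;>
    simp only [hQ, residual_apply_of_onLine, residual_apply_of_not_onLine, not_false_eq_true,
      Finsupp.single_apply] <;> grind

lemma degree_eq_lineDegree_add_degree_residual (Z : FatPoints k) (a : Fin 3 → k) :
    Z.degree = Z.lineDegree a + (Z.residual a).degree := by
  classical
  have hsubset : (Z.residual a).support ⊆ Z.support := Finsupp.support_onFinset_subset
  rw [degree, degree, Finsupp.sum_of_support_subset _ hsubset _ fun _ _ => rfl, lineDegree,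
    Finset.sum_filter, Finsupp.sum, ← Finset.sum_add_distrib]
  refine Finset.sum_congr rfl fun P hP => ?_
  obtain ⟨m, hm⟩ := Nat.exists_eq_succ_of_ne_zero (Finsupp.mem_support_iff.1 hP)
  by_cases h : OnLine P a
  · rw [if_pos h, residual_apply_of_onLine h, hm, Nat.succ_sub_one, Nat.choose_succ_succ,
      Nat.choose_one_right]
  · rw [if_neg h, residual_apply_of_not_onLine h, zero_add]

lemma mem_ideal_iff {f : MvPolynomial (Fin 3) k} :
    f ∈ Z.ideal ↔ ∀ P, f ∈ pointIdeal P ^ Z P := by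
  simp only [ideal, Submodule.mem_iInf]
  refine forall_congr' fun P => ⟨fun h => ?_, fun h _ => h⟩
  by_cases hP : P ∈ Z.support
  · exact h hP
  · simp [Finsupp.notMem_support_iff.1 hP]

lemma mul_linearForm_mem_ideal_iff (ha : a ≠ 0) {g : MvPolynomial (Fin 3) k} :
    g * linearForm a ∈ Z.ideal ↔ g ∈ (Z.residual a).ideal := by
  simp only [mem_ideal_iff]
  refine forall_congr' fun P => ?_
  by_cases hP : OnLine P a
  · rw [residual_apply_of_onLine hP]
    cases Z P with
    | zero => simp
    | succ m => exact mul_linearForm_mem_pointIdeal_pow_succ_iff ha hP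
  · rw [residual_apply_of_not_onLine hP]
    refine mul_mem_pointIdeal_pow_iff_of_eval_ne_zero (isHomogeneous_linearForm a) ?_
    rwa [eval_linearForm]

lemma mem_idealPiece_iff {t : ℕ} {f : homogeneousSubmodule (Fin 3) k t} :
    f ∈ Z.idealPiece t ↔ (f : MvPolynomial (Fin 3) k) ∈ Z.ideal := Iff.rfl

lemma hilbertFunction_succ (hj : a j ≠ 0) (t : ℕ) :
    Z.hilbertFunction (t + 1) =
      (Z.residual a).hilbertFunction t + Z.lineConditions a j (t + 1) := by
  have ha : a ≠ 0 := Function.ne_iff.2 ⟨j, hj⟩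
  have hcomap : (Z.idealPiece (t + 1)).comap (mulForm (isHomogeneous_linearForm a) t) =
      (Z.residual a).idealPiece t := by
    ext g
    exact mul_linearForm_mem_ideal_iff ha
  rw [hilbertFunction, hilbertFunction, lineConditions, ← hcomap]
  exact finrank_quotient_eq_add_of_exact (mulForm_injective _ (linearForm_ne_zero ha) t)
    (restrictForm_surjective a j (t + 1)) (ker_restrictForm hj t) _

lemma lineConditions_le_hilbertFunction (t : ℕ) :
    Z.lineConditions a j t ≤ Z.hilbertFunction t :=
  finrank_quotient_map_le (restrictForm_surjective a j t) _

lemma lineConditions_le_add_one (t : ℕ) : Z.lineConditions a j t ≤ t + 1 :=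
  (Submodule.finrank_quotient_le _).trans_eq (finrank_binaryForms k t)

lemma min_lineDegree_le_lineConditions (hj : a j ≠ 0) (t : ℕ) :
    min (Z.lineDegree a) (t + 1) ≤ Z.lineConditions a j t := by
  classical
  let q := ∏ P ∈ Z.support with OnLine P a, pointForm (j.removeNth P.rep) ^ Z P
  have hq : q.IsHomogeneous (Z.lineDegree a) := by
    refine IsHomogeneous.prod _ _ _ fun P _ => ?_
    simpa only [one_mul] using (isHomogeneous_pointForm (j.removeNth P.rep)).pow (Z P)
  have hq0 : q ≠ 0 := Finset.prod_ne_zero_iff.2 fun P hP =>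
    pow_ne_zero _ (prime_pointForm (removeNth_rep_ne_zero hj (Finset.mem_filter.1 hP).2)).ne_zero
  refine min_le_finrank_quotient_binaryForms hq hq0 ?_
  rintro _ ⟨f, hf, rfl⟩
  refine Finset.prod_dvd_of_isRelPrime (fun P hP Q hQ hPQ => ?_) fun P hP => ?_
  · exact (isRelPrime_pointForm_removeNth_rep hj (Finset.mem_filter.1 hP).2
      (Finset.mem_filter.1 hQ).2 hPQ).pow
  · exact pointForm_pow_dvd_hyperplaneRestrict hj (Finset.mem_filter.1 hP).2 (mem_ideal_iff.1 hf P)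

lemma lineConditions_single_le (hj : a j ≠ 0) (hP : OnLine P a) (m t : ℕ) :
    lineConditions (Finsupp.single P m) a j t ≤ m := by
  classical
  have hpointForm := prime_pointForm (removeNth_rep_ne_zero hj hP)
  refine finrank_quotient_binaryForms_le (by simpa using (isHomogeneous_pointForm _).pow m)
    (pow_ne_zero m hpointForm.ne_zero) fun f hdvd => ?_
  refine ⟨⟨rename j.succAbove f, f.2.rename_isHomogeneous⟩, ?_,
    Subtype.ext (hyperplaneRestrict_rename _)⟩
  refine mem_ideal_iff.2 fun Q => ?_
  obtain rfl | hQ := eq_or_ne P Q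
  · rw [Finsupp.single_eq_same]
    obtain ⟨g, hg⟩ := hdvd
    change rename j.succAbove (f : MvPolynomial (Fin 2) k) ∈ _
    rw [hg, map_mul, map_pow]
    exact Ideal.mul_mem_right _ _ (Ideal.pow_mem_pow (rename_pointForm_mem_pointIdeal P j) m)
  · simp [Finsupp.single_eq_of_ne' hQ]

lemma hilbertFunction_zero_le (Z : FatPoints k) : Z.hilbertFunction 0 ≤ 1 :=
  (Submodule.finrank_quotient_le _).trans_eq (by simp [finrank_homogeneousSubmodule])

lemma hilbertFunction_of_eq_zero (t : ℕ) : (0 : FatPoints k).hilbertFunction t = 0 := by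
  have htop : (0 : FatPoints k).idealPiece t = ⊤ :=
    eq_top_iff.2 fun f _ => mem_ideal_iff.2 fun P => by simp
  rw [hilbertFunction, htop]
  exact Module.finrank_zero_of_subsingleton

lemma hilbertFunction_single_le (P : Plane k) (m t : ℕ) :
    hilbertFunction (Finsupp.single P m) t ≤ (m + 1).choose 2 := by
  obtain ⟨a, ha, hP⟩ := exists_onLine P
  obtain ⟨j, hj⟩ := Function.ne_iff.1 ha
  induction m generalizing t with
  | zero => rw [Finsupp.single_zero, hilbertFunction_of_eq_zero]; exact Nat.zero_le _
  | succ m ih =>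
    rw [Nat.choose_succ_succ, Nat.choose_one_right]
    cases t with
    | zero => exact (hilbertFunction_zero_le _).trans (by omega)
    | succ t =>
      rw [hilbertFunction_succ hj, residual_single_of_onLine hP, Nat.add_sub_cancel, add_comm]
      exact add_le_add (lineConditions_single_le hj hP _ _) (ih t)

lemma hilbertFunction_le_degree (Z : FatPoints k) (t : ℕ) : Z.hilbertFunction t ≤ Z.degree := by
  have hle : ⨅ P ∈ Z.support, idealPiece (Finsupp.single P (Z P)) t ≤ Z.idealPiece t := by
    classical
    intro f hf
    simp only [Submodule.mem_iInf, mem_idealPiece_iff, mem_ideal_iff] at hf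
    refine mem_ideal_iff.2 fun P => ?_
    by_cases hP : P ∈ Z.support
    · simpa using hf P hP P
    · simp [Finsupp.notMem_support_iff.1 hP]
  calc Z.hilbertFunction t
      ≤ ∑ P ∈ Z.support, hilbertFunction (Finsupp.single P (Z P)) t :=
        (finrank_quotient_anti hle).trans (finrank_quotient_iInf_le _ _)
    _ ≤ Z.degree := Finset.sum_le_sum fun P _ => hilbertFunction_single_le P _ t

/-- `Z` is reduced to the empty scheme by passing to the residual schemes with respect to the lines
`a 0, …, a (n - 1)` in turn, and `Z i` is the scheme that remains after the first `i` lines. -/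
structure IsFullReduction (Z : ℕ → FatPoints k) (a : ℕ → Fin 3 → k) (n : ℕ) : Prop where
  line_ne_zero : ∀ i < n, a i ≠ 0
  residual_eq : ∀ i < n, (Z i).residual (a i) = Z (i + 1)
  eq_zero : Z n = 0

namespace IsFullReduction

variable {Z : ℕ → FatPoints k} {a : ℕ → Fin 3 → k} {n : ℕ}

lemma tail (h : IsFullReduction Z a (n + 1)) :
    IsFullReduction (fun i => Z (i + 1)) (fun i => a (i + 1)) n where
  line_ne_zero i hi := h.line_ne_zero (i + 1) (Nat.succ_lt_succ hi)
  residual_eq i hi := h.residual_eq (i + 1) (Nat.succ_lt_succ hi)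
  eq_zero := h.eq_zero

lemma degree_eq_sum_lineDegree (h : IsFullReduction Z a n) :
    (Z 0).degree = ∑ i ∈ Finset.range n, (Z i).lineDegree (a i) := by
  induction n generalizing Z a with
  | zero => rw [h.eq_zero, Finset.sum_range_zero, degree, Finsupp.sum_zero_index]
  | succ n ih =>
    rw [Finset.sum_range_succ', ← ih h.tail, add_comm,
      degree_eq_lineDegree_add_degree_residual _ (a 0), h.residual_eq 0 n.succ_pos]

lemma sum_min_le_hilbertFunction (h : IsFullReduction Z a n) (t : ℕ) :
    ∑ i ∈ Finset.range n, min ((Z i).lineDegree (a i)) (t + 1 - i) ≤ (Z 0).hilbertFunction t := by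
  induction n generalizing Z a t with
  | zero => simp
  | succ n ih =>
    obtain ⟨j, hj⟩ := Function.ne_iff.1 (h.line_ne_zero 0 n.succ_pos)
    have hline := min_lineDegree_le_lineConditions (Z := Z 0) hj t
    rw [Finset.sum_range_succ', Nat.sub_zero]
    cases t with
    | zero => simpa using hline.trans (lineConditions_le_hilbertFunction 0)
    | succ t =>
      rw [hilbertFunction_succ hj, h.residual_eq 0 n.succ_pos]
      simpa only [Nat.add_sub_add_right] using add_le_add (ih h.tail t) hline

lemma hilbertFunction_le_sum_min (h : IsFullReduction Z a n)
    (hanti : StrictAntiOn (fun i => (Z i).lineDegree (a i)) (Set.Iio n)) (t : ℕ) :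
    (Z 0).hilbertFunction t ≤ ∑ i ∈ Finset.range n, min ((Z i).lineDegree (a i)) (t + 1 - i) := by
  induction n generalizing Z a t with
  | zero => rw [h.eq_zero, hilbertFunction_of_eq_zero]; exact Nat.zero_le _
  | succ n ih =>
    obtain hlarge | hsmall := le_or_gt (t + 1) ((Z 0).lineDegree (a 0))
    · obtain ⟨j, hj⟩ := Function.ne_iff.1 (h.line_ne_zero 0 n.succ_pos)
      rw [Finset.sum_range_succ', Nat.sub_zero, min_eq_right hlarge]
      cases t with
      | zero => exact (hilbertFunction_zero_le _).trans (Nat.le_add_left _ _)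
      | succ t =>
        rw [hilbertFunction_succ hj, h.residual_eq 0 n.succ_pos]
        simpa only [Nat.add_sub_add_right] using add_le_add
          (ih h.tail (fun i hi i' hi' hii' => hanti (Nat.succ_lt_succ hi) (Nat.succ_lt_succ hi')
            (Nat.succ_lt_succ hii')) t) (lineConditions_le_add_one (t + 1))
    · have hle (i : ℕ) (hi : i < n + 1) : (Z i).lineDegree (a i) + i ≤ t := by
        induction i with
        | zero => omega
        | succ i ihi =>
          have hlt := hanti (show i < n + 1 by omega) hi i.lt_succ_self
          have hprev := ihi (by omega)
          simp only at hlt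
          omega
      calc (Z 0).hilbertFunction t ≤ (Z 0).degree := hilbertFunction_le_degree _ t
        _ = ∑ i ∈ Finset.range (n + 1), (Z i).lineDegree (a i) := h.degree_eq_sum_lineDegree
        _ = ∑ i ∈ Finset.range (n + 1), min ((Z i).lineDegree (a i)) (t + 1 - i) :=
          Finset.sum_congr rfl fun i hi => by
            have hi' := hle i (Finset.mem_range.1 hi)
            omega

theorem hilbertFunction_eq_sum_min (h : IsFullReduction Z a n)
    (hanti : StrictAntiOn (fun i => (Z i).lineDegree (a i)) (Set.Iio n)) (t : ℕ) :
    (Z 0).hilbertFunction t = ∑ i ∈ Finset.range n, min ((Z i).lineDegree (a i)) (t + 1 - i) :=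
  (h.hilbertFunction_le_sum_min hanti t).antisymm (h.sum_min_le_hilbertFunction t)

end IsFullReduction

end FatPoints

section Arrangement

variable {k : Type*} [Field k]

/-- The line with equation `x₀ + r x₁ + r ^ 2 x₂ = 0`. These lines are the points of a smooth conic
in the dual plane, so no three of them are concurrent. -/
def dualConicLine (r : k) : Fin 3 → k := ![1, r, r ^ 2]

/-- The intersection of the lines `dualConicLine x` and `dualConicLine y`: its coordinates are the
coefficients of `(r - x) (r - y)` as a polynomial in `r`. -/
def pairPoint (x y : k) : Plane k :=
  Projectivization.mk k ![x * y, -(x + y), 1] fun h => one_ne_zero (congrFun h 2)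

lemma dualConicLine_ne_zero (r : k) : dualConicLine r ≠ 0 := fun h => one_ne_zero (congrFun h 0)

lemma onLine_pairPoint_dualConicLine {x y r : k} :
    OnLine (pairPoint x y) (dualConicLine r) ↔ r = x ∨ r = y := by
  obtain ⟨u, hu⟩ := Projectivization.exists_smul_eq_mk_rep k ![x * y, -(x + y), 1]
    fun h => one_ne_zero (congrFun h 2)
  have hdot : dualConicLine r ⬝ᵥ ![x * y, -(x + y), 1] = (r - x) * (r - y) := by
    simp only [dualConicLine, Matrix.dotProduct_of_isEmpty, Matrix.cons_dotProduct_cons]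
    ring
  rw [OnLine, pairPoint, ← hu, Units.smul_def, dotProduct_smul, hdot, smul_eq_mul,
    mul_eq_zero_iff_left u.ne_zero, mul_eq_zero, sub_eq_zero, sub_eq_zero]

lemma sym2_mk_eq_of_pairPoint_eq {x y z w : k} (h : pairPoint x y = pairPoint z w) :
    s(x, y) = s(z, w) :=
  Sym2.ext fun r => by
    rw [Sym2.mem_iff, Sym2.mem_iff, ← onLine_pairPoint_dualConicLine, h,
      onLine_pairPoint_dualConicLine]

lemma injOn_pairPoint {a : ℕ → k} (ha : Function.Injective a) :
    Set.InjOn (fun p : ℕ × ℕ => pairPoint (a p.1) (a p.2)) {p | p.1 < p.2} := by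
  rintro ⟨i, j⟩ (hij : i < j) ⟨i', j'⟩ (hij' : i' < j') h
  have := sym2_mk_eq_of_pairPoint_eq h
  simp only [Sym2.eq_iff, ha.eq_iff] at this
  grind

end Arrangement

namespace FatPoints

/-- The number of the indices `i`, `j` of a pair `(i, j)` that lie in `A`. -/
def indexCount (A : Finset ℕ) (p : ℕ × ℕ) : ℕ :=
  (if p.1 ∈ A then 1 else 0) + if p.2 ∈ A then 1 else 0

variable {k : Type*} [Field k]

/-- The intersections of the lines `dualConicLine (a i)` and `dualConicLine (a j)` for `(i, j) ∈ S`,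
where the multiplicity counts those of the two lines whose index lies in `A`. -/
noncomputable def arrangement (a : ℕ → k) (S : Finset (ℕ × ℕ)) (A : Finset ℕ) : FatPoints k :=
  ∑ p ∈ S, Finsupp.single (pairPoint (a p.1) (a p.2)) (indexCount A p)

variable {a : ℕ → k} {S : Finset (ℕ × ℕ)} {A : Finset ℕ}

lemma arrangement_apply (ha : Function.Injective a) (hS : ∀ p ∈ S, p.1 < p.2) {p : ℕ × ℕ}
    (hp : p ∈ S) : arrangement a S A (pairPoint (a p.1) (a p.2)) = indexCount A p := by
  rw [arrangement, Finsupp.finsetSum_apply, Finset.sum_eq_single_of_mem p hp,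
    Finsupp.single_eq_same]
  exact fun q hq hqp => Finsupp.single_eq_of_ne'
    ((injOn_pairPoint ha).ne (hS q hq) (hS p hp) hqp)

lemma support_arrangement_subset [DecidableEq (Plane k)] :
    (arrangement a S A).support ⊆ S.image fun p => pairPoint (a p.1) (a p.2) := by
  refine Finsupp.support_finsetSum.trans (Finset.biUnion_subset.2 fun p hp => ?_)
  exact Finsupp.support_single_subset.trans
    (Finset.singleton_subset_iff.2 (Finset.mem_image_of_mem _ hp))

lemma sum_arrangement (ha : Function.Injective a) (hS : ∀ p ∈ S, p.1 < p.2) {g : Plane k → ℕ → ℕ}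
    (hg : ∀ P, g P 0 = 0) :
    (arrangement a S A).sum g = ∑ p ∈ S, g (pairPoint (a p.1) (a p.2)) (indexCount A p) := by
  classical
  rw [Finsupp.sum_of_support_subset _ support_arrangement_subset _ fun P _ => hg P,
    Finset.sum_image ((injOn_pairPoint ha).mono hS)]
  exact Finset.sum_congr rfl fun p hp => by rw [arrangement_apply ha hS hp]

lemma residual_arrangement (ha : Function.Injective a) (hS : ∀ p ∈ S, p.1 < p.2) {i : ℕ}
    (hi : i ∈ A) :
    (arrangement a S A).residual (dualConicLine (a i)) = arrangement a S (A.erase i) := by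
  classical
  ext P
  by_cases hP : P ∈ S.image fun p => pairPoint (a p.1) (a p.2)
  · obtain ⟨p, hp, rfl⟩ := Finset.mem_image.1 hP
    have hlt := hS p hp
    rw [arrangement_apply ha hS hp]
    by_cases hip : i = p.1 ∨ i = p.2
    · rw [residual_apply_of_onLine (onLine_pairPoint_dualConicLine.2 (by simpa only [ha.eq_iff])),
        arrangement_apply ha hS hp]
      grind [indexCount]
    · rw [residual_apply_of_not_onLine fun h => hip (by
        simpa only [ha.eq_iff] using onLine_pairPoint_dualConicLine.1 h),
        arrangement_apply ha hS hp]
      grind [indexCount]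
  · have hzero (B : Finset ℕ) : arrangement a S B P = 0 :=
      Finsupp.notMem_support_iff.1 fun h => hP (support_arrangement_subset h)
    rw [hzero]
    by_cases h : OnLine P (dualConicLine (a i))
    · rw [residual_apply_of_onLine h, hzero]
    · rw [residual_apply_of_not_onLine h, hzero]

lemma isFullReduction_arrangement (ha : Function.Injective a) (hS : ∀ p ∈ S, p.1 < p.2) (n : ℕ) :
    IsFullReduction (fun i => arrangement a S (Finset.Ico i n)) (fun i => dualConicLine (a i)) n
    where
  line_ne_zero i _ := dualConicLine_ne_zero (a i)
  residual_eq i hi := by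
    rw [residual_arrangement ha hS (Finset.left_mem_Ico.2 hi), Finset.Ico_erase_left]
    rfl
  eq_zero := by simp [arrangement, indexCount]

lemma lineDegree_arrangement (ha : Function.Injective a) (hS : ∀ p ∈ S, p.1 < p.2) (i : ℕ) :
    (arrangement a S A).lineDegree (dualConicLine (a i)) =
      ∑ p ∈ S with i = p.1 ∨ i = p.2, indexCount A p := by
  classical
  rw [lineDegree, Finset.sum_filter, Finset.sum_filter]
  refine (sum_arrangement (g := fun P m => if OnLine P (dualConicLine (a i)) then m else 0) ha hS
    fun P => ite_self 0).trans (Finset.sum_congr rfl fun p _ => ?_)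
  simp only [onLine_pairPoint_dualConicLine, ha.eq_iff]

lemma card_filter_arrangement (ha : Function.Injective a) (hS : ∀ p ∈ S, p.1 < p.2) {m : ℕ}
    (hm : m ≠ 0) :
    ((arrangement a S A).support.filter fun P => arrangement a S A P = m).card =
      (S.filter fun p => indexCount A p = m).card := by
  rw [Finset.card_filter, Finset.card_filter]
  exact sum_arrangement (g := fun _ n => if n = m then 1 else 0) ha hS fun _ => if_neg hm.symm

lemma consistsOf_arrangement (ha : Function.Injective a) (hS : ∀ p ∈ S, p.1 < p.2) :
    (arrangement a S A).ConsistsOf (S.filter fun p => indexCount A p = 2).card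
      (S.filter fun p => indexCount A p = 1).card := by
  classical
  refine ⟨fun P hP => ?_, card_filter_arrangement ha hS two_ne_zero,
    card_filter_arrangement ha hS one_ne_zero⟩
  obtain ⟨p, hp, rfl⟩ := Finset.mem_image.1 (support_arrangement_subset hP)
  rw [Finsupp.mem_support_iff, arrangement_apply ha hS hp] at hP
  rw [arrangement_apply ha hS hp]
  grind [indexCount]

lemma ConsistsOf.degree_eq {Z : FatPoints k} {e r : ℕ} (h : Z.ConsistsOf e r) :
    Z.degree = 3 * e + r := by
  obtain ⟨hZ, rfl, rfl⟩ := h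
  rw [degree, Finsupp.sum, Finset.card_filter, Finset.card_filter, Finset.mul_sum,
    ← Finset.sum_add_distrib]
  refine Finset.sum_congr rfl fun P hP => ?_
  obtain h | h := hZ P hP <;> simp [h]

end FatPoints

namespace IsValidHilbertFunction

variable {h : ℕ → ℕ} {α σ : ℕ}

lemma antitoneOn (hh : IsValidHilbertFunction h α σ) : AntitoneOn h (Set.Ici (α - 1)) :=
  antitoneOn_of_succ_le Set.ordConnected_Ici fun m _ hm _ =>
    hh.anti m (Nat.sub_le_iff_le_add.1 hm)

lemma le_alpha (hh : IsValidHilbertFunction h α σ) (m : ℕ) : h m ≤ α := by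
  have hα := hh.alpha_pos
  obtain hm | hm := lt_or_ge m α
  · rw [hh.initial m hm]
    exact hm
  · have hanti := hh.antitoneOn Set.self_mem_Ici (Set.mem_Ici.2 (by omega)) (by omega : α - 1 ≤ m)
    rw [hh.initial (α - 1) (by omega)] at hanti
    omega

lemma exists_succ_le_iff (hh : IsValidHilbertFunction h α σ) {j : ℕ} (hj : j < α) :
    ∃ n ≤ σ + 1, ∀ m, j + 1 ≤ h m ↔ j ≤ m ∧ m < n := by
  classical
  have hlast : α ≤ σ + 1 ∧ h (σ + 1) < j + 1 :=
    ⟨hh.alpha_le, (hh.zero _ σ.lt_succ_self).trans_lt j.succ_pos⟩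
  have hex : ∃ n, α ≤ n ∧ h n < j + 1 := ⟨σ + 1, hlast⟩
  obtain ⟨hαn, hn⟩ := Nat.find_spec hex
  refine ⟨Nat.find hex, Nat.find_min' hex hlast, fun m => ?_⟩
  obtain hm | hm := lt_or_ge m α
  · rw [hh.initial m hm]
    omega
  · refine ⟨fun hjm => ⟨by omega, ?_⟩, fun hmn => ?_⟩
    · by_contra! hle
      exact (hn.trans_le hjm).not_ge (hh.antitoneOn (Set.mem_Ici.2 (by omega))
        (Set.mem_Ici.2 (by omega)) hle)
    · have hmin := Nat.find_min hex hmn.2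
      omega

lemma succ_le_iff (hh : IsValidHilbertFunction h α σ) {j : ℕ} (hj : j < α) (m : ℕ) :
    j + 1 ≤ h m ↔ j ≤ m ∧ m < j + conjugate h σ (j + 1) := by
  obtain ⟨n, hn, hiff⟩ := hh.exists_succ_le_iff hj
  have hjn : j < n := ((hiff j).1 (hh.initial j hj).ge).2
  have hcard : conjugate h σ (j + 1) = n - j := by
    rw [conjugate, ← Nat.card_Ico]
    congr 1
    ext m
    rw [Finset.mem_filter, hiff, Finset.mem_range, Finset.mem_Ico]
    omega
  rw [hiff, hcard, Nat.add_sub_cancel' hjn.le]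

lemma conjugate_pos (hh : IsValidHilbertFunction h α σ) {j : ℕ} (hj : j < α) :
    0 < conjugate h σ (j + 1) := by
  have hlt := ((hh.succ_le_iff hj j).1 (hh.initial j hj).ge).2
  omega

lemma conjugate_one (hh : IsValidHilbertFunction h α σ) : conjugate h σ 1 = σ + 1 := by
  rw [conjugate, Finset.filter_true_of_mem, Finset.card_range]
  exact fun j hj => hh.pos j (Finset.mem_range_succ_iff.1 hj)

lemma strictAntiOn_conjugate (hh : IsValidHilbertFunction h α σ) :
    StrictAntiOn (fun j => conjugate h σ (j + 1)) (Set.Iio α) :=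
  strictAntiOn_of_succ_lt Set.ordConnected_Iio fun j _ hj hj' => by
    have hj' : j + 1 < α := hj'
    have hpos := hh.conjugate_pos hj
    have hle := (hh.succ_le_iff hj' (j + conjugate h σ (j + 1 + 1))).2
    have hlt := (hh.succ_le_iff hj (j + conjugate h σ (j + 1 + 1))).1
    simp only [Order.succ_eq_add_one]
    omega

lemma sum_eq_sum_card (hh : IsValidHilbertFunction h α σ) (s : Finset ℕ) :
    ∑ m ∈ s, h m = ∑ j ∈ Finset.range α, (s.filter fun m => j + 1 ≤ h m).card := by
  have hcount (m : ℕ) : ((Finset.range α).filter fun j => j + 1 ≤ h m).card = h m := by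
    have hle := hh.le_alpha m
    conv_rhs => rw [← Finset.card_range (h m)]
    congr 1
    ext j
    rw [Finset.mem_filter, Finset.mem_range, Finset.mem_range]
    omega
  calc ∑ m ∈ s, h m = ∑ m ∈ s, ((Finset.range α).filter fun j => j + 1 ≤ h m).card :=
        Finset.sum_congr rfl fun m _ => (hcount m).symm
    _ = ∑ j ∈ Finset.range α, (s.filter fun m => j + 1 ≤ h m).card :=
        Finset.sum_card_bipartiteAbove_eq_sum_card_bipartiteBelow _

lemma totalSum_eq (hh : IsValidHilbertFunction h α σ) :
    totalSum h σ = ∑ j ∈ Finset.range α, conjugate h σ (j + 1) :=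
  hh.sum_eq_sum_card _

lemma sumFunction_eq (hh : IsValidHilbertFunction h α σ) (t : ℕ) :
    sumFunction h t = ∑ j ∈ Finset.range α, min (conjugate h σ (j + 1)) (t + 1 - j) := by
  rw [sumFunction, hh.sum_eq_sum_card]
  refine Finset.sum_congr rfl fun j hj => ?_
  have hfilter : (Finset.range (t + 1)).filter (fun m => j + 1 ≤ h m) =
      Finset.Ico j (min (t + 1) (j + conjugate h σ (j + 1))) := by
    ext m
    rw [Finset.mem_filter, Finset.mem_range, hh.succ_le_iff (Finset.mem_range.1 hj),
      Finset.mem_Ico, lt_min_iff, and_left_comm]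
  rw [hfilter, Nat.card_Ico]
  omega

end IsValidHilbertFunction

section DoublePointNumber

lemma doublePointNumber_eq (h : ℕ → ℕ) (α σ : ℕ) :
    doublePointNumber h α σ = ∑ i ∈ Finset.range (α - 1),
      min ((conjugate h σ (i + 1) - i) / 2)
        ((Finset.Ioo i α).filter fun j => i + 1 ≤ conjugate h σ (j + 1)).card := by
  rw [doublePointNumber, ← Finset.Ico_succ_right_eq_Icc, Finset.sum_Ico_eq_sum_range]
  refine Finset.sum_congr (by rw [Order.succ_eq_add_one, Nat.add_sub_cancel]) fun i _ => ?_
  have hshift : (Finset.Icc (i + 1 + 1) α).filter (fun j => i + 1 ≤ conjugate h σ j) =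
      ((Finset.Ioo i α).filter fun j => i + 1 ≤ conjugate h σ (j + 1)).map
        (addRightEmbedding 1) := by
    ext (_ | j) <;> simp
  rw [add_comm 1 i, Nat.add_sub_cancel, hshift, Finset.card_map]

lemma doublePointNumber_le_choose (h : ℕ → ℕ) (α σ : ℕ) :
    doublePointNumber h α σ ≤ α.choose 2 := by
  calc doublePointNumber h α σ ≤ ∑ i ∈ Finset.range (α - 1), (α - 1 - i) := by
        rw [doublePointNumber_eq]
        refine Finset.sum_le_sum fun i _ => (min_le_right _ _).trans ?_
        exact (Finset.card_filter_le _ _).trans_eq (by rw [Nat.card_Ioo]; omega)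
    _ ≤ ∑ i ∈ Finset.range α, (α - 1 - i) :=
        Finset.sum_le_sum_of_subset (Finset.range_mono (Nat.sub_le α 1))
    _ = α.choose 2 := by
        rw [Finset.sum_range_reflect (fun i => i), Finset.sum_range_id, Nat.choose_two_right]

lemma IsValidHilbertFunction.min_le_doublePointNumber {h : ℕ → ℕ} {α σ : ℕ}
    (hh : IsValidHilbertFunction h α σ) :
    min ((σ + 1) / 2) (α - 1) ≤ doublePointNumber h α σ := by
  obtain hα | hα := Nat.eq_zero_or_pos (α - 1)
  · rw [hα, Nat.min_zero]
    exact Nat.zero_le _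
  · rw [doublePointNumber_eq]
    refine le_trans (Eq.le ?_)
      (Finset.single_le_sum (fun _ _ => Nat.zero_le _) (Finset.mem_range.2 hα))
    have hall : (Finset.Ioo 0 α).filter (fun j => 0 + 1 ≤ conjugate h σ (j + 1)) =
        Finset.Ioo 0 α :=
      Finset.filter_true_of_mem fun j hj => hh.conjugate_pos (Finset.mem_Ioo.1 hj).2
    rw [hall, Nat.card_Ioo, zero_add, hh.conjugate_one]
    rfl

end DoublePointNumber

section Configuration

open FatPoints

/-- The pairs `(i, j)` with `i < n` and `j ∈ T i`. -/
def fiberedPairs (n : ℕ) (T : ℕ → Finset ℕ) : Finset (ℕ × ℕ) :=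
  ((Finset.range n).sigma T).map (Equiv.sigmaEquivProd ℕ ℕ).toEmbedding

/-- The degree on the `i`-th line of what remains of `arrangement a S (Finset.range n)` after
passing to the residual schemes with respect to the lines `0, …, i - 1`. -/
def residualLoad (n : ℕ) (S : Finset (ℕ × ℕ)) (i : ℕ) : ℕ :=
  ∑ p ∈ S with i = p.1 ∨ i = p.2, indexCount (Finset.Ico i n) p

variable {n i : ℕ} {T : ℕ → Finset ℕ} {c : ℕ → ℕ} {E F : Finset (ℕ × ℕ)}

lemma mem_fiberedPairs {p : ℕ × ℕ} : p ∈ fiberedPairs n T ↔ p.1 < n ∧ p.2 ∈ T p.1 := by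
  simp [fiberedPairs]

lemma card_fiberedPairs : (fiberedPairs n T).card = ∑ i ∈ Finset.range n, (T i).card := by
  rw [fiberedPairs, Finset.card_map, Finset.card_sigma]

lemma card_filter_fst_fiberedPairs (hi : i < n) :
    ((fiberedPairs n T).filter fun p => p.1 = i).card = (T i).card := by
  rw [← Finset.card_map (s := T i) ⟨Prod.mk i, Prod.mk_right_injective i⟩]
  congr 1
  ext ⟨i', j⟩
  simp only [Finset.mem_filter, mem_fiberedPairs, Finset.mem_map, Function.Embedding.coeFn_mk,
    Prod.mk.injEq]
  grind

lemma residualLoad_union (hEF : Disjoint E F) :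
    residualLoad n (E ∪ F) i = residualLoad n E i + residualLoad n F i := by
  simp only [residualLoad, Finset.sum_filter, Finset.sum_union hEF]

lemma residualLoad_of_snd_lt (hE : ∀ p ∈ E, p.1 < p.2 ∧ p.2 < n) :
    residualLoad n E i =
      2 * (E.filter fun p => p.1 = i).card + (E.filter fun p => p.2 = i).card := by
  rw [residualLoad, Finset.sum_filter, Finset.card_filter, Finset.card_filter, Finset.mul_sum,
    ← Finset.sum_add_distrib]
  refine Finset.sum_congr rfl fun p hp => ?_
  have hlt := hE p hp
  simp only [indexCount, Finset.mem_Ico]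
  split_ifs <;> omega

lemma residualLoad_of_le_snd (hF : ∀ p ∈ F, p.1 < n ∧ n ≤ p.2) (hi : i < n) :
    residualLoad n F i = (F.filter fun p => p.1 = i).card := by
  rw [residualLoad, Finset.sum_filter, Finset.card_filter]
  refine Finset.sum_congr rfl fun p hp => ?_
  have hlt := hF p hp
  simp only [indexCount, Finset.mem_Ico]
  split_ifs <;> omega

lemma exists_pairs_residualLoad_le {e : ℕ}
    (he : e ≤ ∑ i ∈ Finset.range n,
      min ((c i - i) / 2) ((Finset.Ioo i n).filter fun j => i + 1 ≤ c j).card) :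
    ∃ E : Finset (ℕ × ℕ), E.card = e ∧ (∀ p ∈ E, p.1 < p.2 ∧ p.2 < n) ∧
      ∀ i < n, residualLoad n E i ≤ c i := by
  choose T hT hTcard using fun i => Finset.exists_subset_card_eq
    (min_le_right ((c i - i) / 2) ((Finset.Ioo i n).filter fun j => i + 1 ≤ c j).card)
  obtain ⟨E, hE, hEcard⟩ : ∃ E ⊆ fiberedPairs n T, E.card = e :=
    Finset.exists_subset_card_eq (by simpa only [card_fiberedPairs, hTcard] using he)
  have hmem (p : ℕ × ℕ) (hp : p ∈ E) : (p.1 < p.2 ∧ p.2 < n) ∧ p.1 + 1 ≤ c p.2 := by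
    simpa only [Finset.mem_filter, Finset.mem_Ioo] using hT _ (mem_fiberedPairs.1 (hE hp)).2
  refine ⟨E, hEcard, fun p hp => (hmem p hp).1, fun i hi => ?_⟩
  have hfst : (E.filter fun p => p.1 = i).card ≤ (c i - i) / 2 := calc
    _ ≤ (T i).card := (Finset.card_le_card (Finset.filter_subset_filter _ hE)).trans_eq
        (card_filter_fst_fiberedPairs hi)
    _ ≤ (c i - i) / 2 := (hTcard i).trans_le (min_le_left _ _)
  have hsnd : (E.filter fun p => p.2 = i).card ≤ min i (c i) := by
    rw [← Finset.card_range (min i (c i))]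
    refine Finset.card_le_card_of_injOn Prod.fst (fun p hp => ?_) fun p hp q hq hpq => ?_
    · obtain ⟨hpE, rfl⟩ := Finset.mem_filter.1 hp
      have hlt := hmem p hpE
      exact Finset.mem_coe.2 (Finset.mem_range.2 (by omega))
    · exact Prod.ext hpq ((Finset.mem_filter.1 hp).2.trans (Finset.mem_filter.1 hq).2.symm)
  rw [residualLoad_of_snd_lt fun p hp => (hmem p hp).1]
  omega

lemma exists_residualLoad_eq (hE : ∀ p ∈ E, p.1 < p.2 ∧ p.2 < n)
    (hcap : ∀ i < n, residualLoad n E i ≤ c i) :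
    ∃ S : Finset (ℕ × ℕ), (∀ p ∈ S, p.1 < p.2 ∧ p.1 < n) ∧ (S.filter fun p => p.2 < n) = E ∧
      ∀ i < n, residualLoad n S i = c i := by
  let F := fiberedPairs n fun i => Finset.Ico n (n + (c i - residualLoad n E i))
  have hF (p : ℕ × ℕ) (hp : p ∈ F) : p.1 < n ∧ n ≤ p.2 :=
    (mem_fiberedPairs.1 hp).imp_right fun h => (Finset.mem_Ico.1 h).1
  have hdisj : Disjoint E F := Finset.disjoint_left.2 fun p hpE hpF =>
    (hE p hpE).2.not_ge (hF p hpF).2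
  refine ⟨E ∪ F, fun p hp => ?_, ?_, fun i hi => ?_⟩
  · obtain hp | hp := Finset.mem_union.1 hp
    · exact ⟨(hE p hp).1, (hE p hp).1.trans (hE p hp).2⟩
    · exact ⟨(hF p hp).1.trans_le (hF p hp).2, (hF p hp).1⟩
  · rw [Finset.filter_union, Finset.filter_true_of_mem fun p hp => (hE p hp).2,
      Finset.filter_false_of_mem fun p hp => (hF p hp).2.not_gt, Finset.union_empty]
  · rw [residualLoad_union hdisj, residualLoad_of_le_snd hF hi, card_filter_fst_fiberedPairs hi,
      Nat.card_Ico, Nat.add_sub_cancel_left, Nat.add_sub_cancel' (hcap i hi)]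

end Configuration

theorem FatPoints.exists_consistsOf_hilbertFunction_eq (k : Type*) [Field k] [Infinite k]
    {c : ℕ → ℕ} {n e : ℕ} (hc : StrictAntiOn c (Set.Iio n))
    (he : e ≤ ∑ i ∈ Finset.range n,
      min ((c i - i) / 2) ((Finset.Ioo i n).filter fun j => i + 1 ≤ c j).card) :
    ∃ (Z : FatPoints k) (r : ℕ), Z.ConsistsOf e r ∧ 3 * e + r = ∑ i ∈ Finset.range n, c i ∧
      ∀ t, Z.hilbertFunction t = ∑ i ∈ Finset.range n, min (c i) (t + 1 - i) := by
  obtain ⟨E, rfl, hE, hcap⟩ := exists_pairs_residualLoad_le he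
  obtain ⟨S, hS, rfl, hload⟩ := exists_residualLoad_eq hE hcap
  have hlt (p : ℕ × ℕ) (hp : p ∈ S) : p.1 < p.2 := (hS p hp).1
  let a := Infinite.natEmbedding k
  have hreduction := isFullReduction_arrangement a.injective hlt n
  have hdegree (i : ℕ) (hi : i < n) :
      (arrangement a S (Finset.Ico i n)).lineDegree (dualConicLine (a i)) = c i :=
    (lineDegree_arrangement a.injective hlt i).trans (hload i hi)
  have hdouble : (S.filter fun p => indexCount (Finset.Ico 0 n) p = 2) =
      S.filter fun p => p.2 < n :=
    Finset.filter_congr fun p hp => by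
      have := hS p hp
      grind [indexCount]
  have hconsists := consistsOf_arrangement (A := Finset.Ico 0 n) a.injective hlt
  rw [hdouble] at hconsists
  refine ⟨_, _, hconsists, ?_, fun t => ?_⟩
  · rw [← hconsists.degree_eq, hreduction.degree_eq_sum_lineDegree]
    exact Finset.sum_congr rfl fun i hi => hdegree i (Finset.mem_range.1 hi)
  · rw [hreduction.hilbertFunction_eq_sum_min (hc.congr fun i hi => (hdegree i hi).symm)]
    exact Finset.sum_congr rfl fun i hi => by rw [hdegree i (Finset.mem_range.1 hi)]

theorem mainTheorem6_general (k : Type*) [Field k] [Infinite k]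
    (h : ℕ → ℕ) (α σ : ℕ) (hh : IsValidHilbertFunction h α σ) :
    (min ((σ + 1) / 2) (α - 1) ≤ doublePointNumber h α σ ∧
      doublePointNumber h α σ ≤ Nat.choose α 2) ∧
    ∀ e : ℕ, e ≤ doublePointNumber h α σ →
      3 * e ≤ totalSum h σ ∧
      ∃ Z : FatPoints k, Z.ConsistsOf e (totalSum h σ - 3 * e) ∧
        Z.hilbertFunction = sumFunction h := by
  refine ⟨⟨hh.min_le_doublePointNumber, doublePointNumber_le_choose h α σ⟩, fun e he => ?_⟩
  rw [doublePointNumber_eq] at he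
  obtain ⟨Z, r, hconsists, hsum, hhilbert⟩ :=
    FatPoints.exists_consistsOf_hilbertFunction_eq k hh.strictAntiOn_conjugate
      (he.trans (Finset.sum_le_sum_of_subset (Finset.range_mono (Nat.sub_le α 1))))
  rw [← hh.totalSum_eq] at hsum
  refine ⟨hsum ▸ Nat.le_add_right _ _, Z, ?_, funext fun t => ?_⟩
  · rwa [← hsum, Nat.add_sub_cancel_left]
  · rw [hhilbert, hh.sumFunction_eq]

theorem mainTheorem6 (k : Type*) [Field k] [IsAlgClosed k] [CharZero k]
    (h : ℕ → ℕ) (α σ : ℕ) (hh : IsValidHilbertFunction h α σ) :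
    (min ((σ + 1) / 2) (α - 1) ≤ doublePointNumber h α σ ∧
      doublePointNumber h α σ ≤ Nat.choose α 2) ∧
    (∀ e : ℕ, 1 ≤ e → e ≤ doublePointNumber h α σ →
      3 * e ≤ totalSum h σ ∧
      ∃ Z : FatPoints k, Z.ConsistsOf e (totalSum h σ - 3 * e) ∧
        Z.hilbertFunction = sumFunction h) ∧
    (∀ e : ℕ, e = min ((σ + 1) / 2) (α - 1) →
      3 * e ≤ totalSum h σ ∧
      ∃ Z : FatPoints k, Z.ConsistsOf e (totalSum h σ - 3 * e) ∧
        Z.hilbertFunction = sumFunction h) :=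
  have ⟨hd, hexists⟩ := mainTheorem6_general k h α σ hh
  ⟨hd, fun e _ => hexists e, fun e he => hexists e (he.trans_le hd.1)⟩
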